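/- Let $d\ge 1$, $0<\sigma<\frac2d$ and $\lambda>0$. For $u\in\ell^2(\mathbb Z^d)$ let $(\Delta u)_n=\sum_{|j-n|=1}u_j-2d\,u_n$ and $$H[u]=\sum_{\{j,n\}:\,|j-n|=1}|u_j-u_n|^2-\frac1{\sigma+1}\sum_{n\in\mathbb Z^d}|u_n|^{2\sigma+2},$$ where each pair of nearest neighbours is counted once (so the first sum is $\langle-\Delta u,u\rangle$). A normalized wave is a minimizer $u=u_\lambda$ of $H$ over $\{v\in\ell^2(\mathbb Z^d):\|v\|_{\ell^2}^2=\lambda\}$ with non-negative entries. For every normalized wave $u$ there is a Lagrange multiplier $c=c(\lambda)>0$ such that $$-\Delta u_n+c\,u_n-u_n^{2\sigma+1}=0,\qquad n\in\mathbb Z^d,$$ and, with the bounded operators on $\ell^2(\mathbb Z^d)$ $$\mathcal L_+=-\Delta+c-(2\sigma+1)u_n^{2\sigma},\qquad \mathcal L_-=-\Delta+c-u_n^{2\sigma},$$ the following hold. 1. $\mathcal L_-\ge0$ and $\ker\mathcal L_-=\mathrm{span}(u)$. 2. $u\perp\ker\mathcal L_+$, and there is exactly one $\varphi\in(\ker\mathcal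 L_+)^\perp$ with $\mathcal L_+\varphi=u$; it is denoted $\mathcal L_+^{-1}u$. 3. $\langle\mathcal L_+^{-1}u,u\rangle\le0$. 4. If $\langle\mathcal L_+^{-1}u,u\rangle\ne0$, then $\langle\mathcal L_+^{-1}u,u\rangle<0$ and the wave $e^{itc(\lambda)}u_\lambda$ is spectrally stable, that is, the eigenvalue problem $$\begin{pmatrix}0&-1\\1&0\end{pmatrix}\begin{pmatrix}\mathcal L_+&0\\0&\mathcal L_-\end{pmatrix}\begin{pmatrix}v\\w\end{pmatrix}=\mu\begin{pmatrix}v\\w\end{pmatrix}$$ has no solution with $\mathrm{Re}\,\mu>0$ and $(0,0)\ne(v,w)\in\ell^2(\mathbb Z^d)\times\ell^2(\mathbb Z^d)$ (complex sequences). -/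

import Mathlib

open scoped ComplexOrder InnerProductSpace

noncomputable section

namespace DNLS

/-- The complex Hilbert space `ℓ²(ℤᵈ)`; its norm satisfies `‖u‖² = ∑ₙ |uₙ|²`. -/
abbrev Ell2 (d : ℕ) : Type := lp (fun _ : Fin d → ℤ => ℂ) 2

theorem memℓp_two_iff {d : ℕ} {f : (Fin d → ℤ) → ℂ} :
    Memℓp f 2 ↔ Summable fun n => ‖f n‖ ^ 2 := by
  have h := memℓp_gen_iff (f := f) (p := 2) (by norm_num)
  simpa using h

theorem norm_sq_eq_tsum {d : ℕ} (u : Ell2 d) : ‖u‖ ^ 2 = ∑' n, ‖u n‖ ^ 2 := by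
  have h := lp.norm_rpow_eq_tsum (p := 2) (by norm_num) u
  simpa using h

theorem summable_norm_sq {d : ℕ} (u : Ell2 d) : Summable fun n => ‖u n‖ ^ 2 :=
  memℓp_two_iff.1 (lp.memℓp u)

theorem summable_translate {d : ℕ} (a : Fin d → ℤ) (u : Ell2 d) :
    Summable fun n => ‖u (n + a)‖ ^ 2 :=
  (Equiv.addRight a).summable_iff (f := fun n => ‖u n‖ ^ 2) |>.2 (summable_norm_sq u)

/-- The translation `(translate a u)ₙ = u_{n+a}` on `ℓ²(ℤᵈ)`. -/
def translate {d : ℕ} (a : Fin d → ℤ) : Ell2 d →ₗᵢ[ℂ] Ell2 d where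
  toFun u := ⟨fun n => u (n + a),
    memℓp_two_iff.2 (summable_translate a u)⟩
  map_add' _ _ := rfl
  map_smul' _ _ := rfl
  norm_map' u := by
    refine (sq_eq_sq₀ (norm_nonneg _) (norm_nonneg _)).1 ?_
    rw [norm_sq_eq_tsum, norm_sq_eq_tsum]
    exact (Equiv.addRight a).tsum_eq fun n => ‖u n‖ ^ 2

/-- The `i`-th unit vector of `ℤᵈ`. The lattice points `j` with `|j - n| = 1` (Euclidean distance)
are exactly the `2d` points `n + unit i` and `n - unit i`. -/
def unit {d : ℕ} (i : Fin d) : Fin d → ℤ := Pi.single i 1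

/-- The discrete Laplacian `(Δu)ₙ = ∑_{|j-n|=1} u_j - 2d uₙ`, a bounded operator on `ℓ²(ℤᵈ)`. -/
def laplacian (d : ℕ) : Ell2 d →L[ℂ] Ell2 d :=
  ∑ i : Fin d, ((translate (unit i)).toContinuousLinearMap +
    (translate (-unit i)).toContinuousLinearMap) -
      (2 * d : ℂ) • ContinuousLinearMap.id ℂ (Ell2 d)

theorem laplacian_apply {d : ℕ} (u : Ell2 d) (n : Fin d → ℤ) :
    laplacian d u n = ∑ i, (u (n + unit i) + u (n - unit i)) - 2 * d * u n := by
  simp only [laplacian, sub_apply, sum_apply, smul_apply, lp.coeFn_sub, lp.coeFn_sum, Pi.sub_apply, Finset.sum_apply]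
  rfl

/-- Multiplication by a bounded real potential, as a bounded operator on `ℓ²(ℤᵈ)`. -/
def multiplication {d : ℕ} (V : (Fin d → ℤ) → ℝ) (C : ℝ) (hV : ∀ n, |V n| ≤ C) :
    Ell2 d →L[ℂ] Ell2 d :=
  have key : ∀ (u : Ell2 d) (n : Fin d → ℤ), ‖(V n : ℂ) * u n‖ ^ 2 ≤ C ^ 2 * ‖u n‖ ^ 2 := by
    intro u n
    rw [norm_mul, mul_pow, Complex.norm_real, Real.norm_eq_abs]
    have := hV n
    gcongr
  have hs : ∀ u : Ell2 d, Summable fun n => ‖(V n : ℂ) * u n‖ ^ 2 := fun u =>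
    Summable.of_nonneg_of_le (fun _ => by positivity) (key u) ((summable_norm_sq u).mul_left _)
  LinearMap.mkContinuous
    { toFun := fun u => ⟨fun n => (V n : ℂ) * u n, memℓp_two_iff.2 (hs u)⟩
      map_add' := fun u v => by
        ext n
        exact mul_add _ _ _
      map_smul' := fun a u => by
        ext n
        exact mul_left_comm _ _ _ }
    C (fun u => by
      have hC : 0 ≤ C := (abs_nonneg _).trans (hV 0)
      refine (sq_le_sq₀ (norm_nonneg _) (by positivity)).1 ?_
      rw [mul_pow, norm_sq_eq_tsum, norm_sq_eq_tsum u, ← tsum_mul_left]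
      exact (hs u).tsum_le_tsum (key u) ((summable_norm_sq u).mul_left _))

theorem multiplication_apply {d : ℕ} (V : (Fin d → ℤ) → ℝ) (C : ℝ) (hV : ∀ n, |V n| ≤ C)
    (u : Ell2 d) (n : Fin d → ℤ) : multiplication V C hV u n = V n * u n := rfl

theorem abs_potential_le {d : ℕ} {σ : ℝ} (hσ : 0 < σ) (φ : Ell2 d) (n : Fin d → ℤ) :
    |‖φ n‖ ^ (2 * σ)| ≤ ‖φ‖ ^ (2 * σ) := by
  rw [abs_of_nonneg (by positivity)]
  exact Real.rpow_le_rpow (norm_nonneg _) (lp.norm_apply_le_norm (by norm_num) φ n) (by positivity)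

/-- The potential `|φₙ|^{2σ}`, as a multiplication operator on `ℓ²(ℤᵈ)`. -/
def potential {d : ℕ} {σ : ℝ} (hσ : 0 < σ) (φ : Ell2 d) : Ell2 d →L[ℂ] Ell2 d :=
  multiplication (fun n => ‖φ n‖ ^ (2 * σ)) (‖φ‖ ^ (2 * σ)) (abs_potential_le hσ φ)

/-- `L₊ = -Δ + ω - (2σ+1) |φₙ|^{2σ}`. -/
def Lplus {d : ℕ} {σ : ℝ} (hσ : 0 < σ) (ω : ℝ) (φ : Ell2 d) : Ell2 d →L[ℂ] Ell2 d :=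
  -laplacian d + (ω : ℂ) • ContinuousLinearMap.id ℂ (Ell2 d) -
    ((2 * σ + 1 : ℝ) : ℂ) • potential hσ φ

/-- `L₋ = -Δ + ω - |φₙ|^{2σ}`. -/
def Lminus {d : ℕ} {σ : ℝ} (hσ : 0 < σ) (ω : ℝ) (φ : Ell2 d) : Ell2 d →L[ℂ] Ell2 d :=
  -laplacian d + (ω : ℂ) • ContinuousLinearMap.id ℂ (Ell2 d) - potential hσ φ

/-- Spectral stability of the standing wave `e^{iωt} φₙ` with a real profile `φ`: the eigenvalue
problem `[[0, -1], [1, 0]] [[L₊, 0], [0, L₋]] (v, w) = μ (v, w)` has no non-trivial solution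
`(v, w)` in `ℓ² × ℓ²` with `Re μ > 0`. -/
def IsSpectrallyStable {d : ℕ} {σ : ℝ} (hσ : 0 < σ) (ω : ℝ) (φ : Ell2 d) : Prop :=
  ∀ (μ : ℂ) (v w : Ell2 d), 0 < μ.re →
    -(Lminus hσ ω φ w) = μ • v → Lplus hσ ω φ v = μ • w → v = 0 ∧ w = 0

/-- The Hamiltonian `H[u] = ∑ |u_j - u_n|² - (σ+1)⁻¹ ∑ₙ |uₙ|^{2σ+2}`. The first sum runs over the
nearest-neighbour pairs `{n, j}`, each counted once, so that it equals `⟨-Δu, u⟩`. -/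
def hamiltonian {d : ℕ} (σ : ℝ) (u : Ell2 d) : ℝ :=
  (∑' n : Fin d → ℤ, ∑ i : Fin d, ‖u (n + unit i) - u n‖ ^ 2) -
    1 / (σ + 1) * (∑' n : Fin d → ℤ, ‖u n‖ ^ (2 * σ + 2))

/-- A normalized wave: a minimizer of the Hamiltonian under the constraint `‖u‖² = lam`, with
real non-negative entries. -/
structure IsNormalizedWave {d : ℕ} (σ lam : ℝ) (u : Ell2 d) : Prop where
  norm_sq : ‖u‖ ^ 2 = lam
  minimal : ∀ v : Ell2 d, ‖v‖ ^ 2 = lam → hamiltonian σ u ≤ hamiltonian σ v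
  nonneg : ∀ n, 0 ≤ u n

end DNLS

end

/-! Everything follows from first and second variations at the minimizer `u`. Scaling to the sphere
turns minimality into an inequality for all vectors near `u`, with equality at `u`
(`hamiltonian_mul_rpow_le`). Its first order at one site is the Euler-Lagrange equation
(`re_eulerLagrange`), with `c = (powerSum - dirichlet) / lam`; this is positive because slowly
decaying exponentials give `H[u] ≤ 0`. Its second order gives `⟨L₊v, v⟩ ≥ 0` for `v ⊥ u`
(`second_variation`).

The equation reads `L₋u = 0`, so the form of `L₋` only sees the part orthogonal to `u`, where `L₋ ≥
L₊ ≥ 0`. Its kernel is simple because the absolute value of a kernel element is again in the kernel,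
and zeros of non-negative kernel elements spread over the lattice.

Since `⟨L₊u, u⟩ = -2σ ∑ uₙ^{2σ+2} < 0`, non-negativity on `{u}ᗮ` yields both `u ⊥ ker L₊` and
`⟨L₊⁻¹u, u⟩ ≤ 0`, by testing on suitable combinations orthogonal to `u`. The inverse exists because
`L₊` is self-adjoint with closed range. For an eigenvector `(v, w)` with `Re μ > 0`, `v ⊥ u`, and
the signs of the two forms force `⟨v, w⟩ = 0`, hence `v = w = 0`. -/

noncomputable section

namespace DNLS

variable {d : ℕ} {σ : ℝ}

/-! ### Quadratic forms and symmetry of the operators. -/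

/-- The Dirichlet form `⟨-Δu, u⟩`, as a sum of squared norms of difference quotients. -/
def dirichlet (u : Ell2 d) : ℝ := ∑ i : Fin d, ‖translate (unit i) u - u‖ ^ 2

/-- The nonlinear term `∑ₙ |uₙ|^{2σ+2}`. -/
def powerSum (σ : ℝ) (u : Ell2 d) : ℝ := ∑' n, ‖u n‖ ^ (2 * σ + 2)

/-- The quadratic form of the potential `|φₙ|^{2σ}`. -/
def potentialForm (σ : ℝ) (φ x : Ell2 d) : ℝ := ∑' n, ‖φ n‖ ^ (2 * σ) * ‖x n‖ ^ 2

/-- The operator `-Δ + ω - κ |φₙ|^{2σ}`. -/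
def linearized (hσ : 0 < σ) (κ ω : ℝ) (φ : Ell2 d) : Ell2 d →L[ℂ] Ell2 d :=
  -laplacian d + (ω : ℂ) • ContinuousLinearMap.id ℂ (Ell2 d) - (κ : ℂ) • potential hσ φ

theorem Lminus_eq_linearized (hσ : 0 < σ) (ω : ℝ) (φ : Ell2 d) :
    Lminus hσ ω φ = linearized hσ 1 ω φ := by
  simp [Lminus, linearized]

theorem translate_apply (a : Fin d → ℤ) (u : Ell2 d) (n : Fin d → ℤ) :
    translate a u n = u (n + a) := rfl

theorem translate_neg_translate (a : Fin d → ℤ) (u : Ell2 d) :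
    translate (-a) (translate a u) = u := by
  ext n
  simp [translate_apply]

theorem inner_translate_neg (a : Fin d → ℤ) (x y : Ell2 d) :
    ⟪translate (-a) x, y⟫_ℂ = ⟪x, translate a y⟫_ℂ := by
  rw [← (translate a).inner_map_map (translate (-a) x) y]
  congr 1
  simpa using translate_neg_translate (-a) x

theorem dirichlet_nonneg (u : Ell2 d) : 0 ≤ dirichlet u :=
  Finset.sum_nonneg fun _ _ => by positivity

theorem summable_norm_diff_sq (i : Fin d) (u : Ell2 d) :
    Summable fun n => ‖u (n + unit i) - u n‖ ^ 2 :=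
  summable_norm_sq (translate (unit i) u - u)

theorem norm_diff_sq (i : Fin d) (u : Ell2 d) :
    ‖translate (unit i) u - u‖ ^ 2 = ∑' n, ‖u (n + unit i) - u n‖ ^ 2 :=
  norm_sq_eq_tsum _

theorem hamiltonian_eq (σ : ℝ) (u : Ell2 d) :
    hamiltonian σ u = dirichlet u - 1 / (σ + 1) * powerSum σ u := by
  unfold hamiltonian dirichlet powerSum
  rw [Summable.tsum_finsetSum fun i _ => summable_norm_diff_sq i u]
  simp_rw [norm_diff_sq]

theorem laplacian_eq (u : Ell2 d) :
    laplacian d u =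
      ∑ i : Fin d, (translate (unit i) u + translate (-unit i) u) - (2 * d : ℂ) • u := by
  simp only [laplacian, sub_apply, sum_apply, smul_apply]
  rfl

theorem inner_laplacian_left (x y : Ell2 d) :
    ⟪laplacian d x, y⟫_ℂ =
      ∑ i : Fin d, (⟪translate (unit i) x, y⟫_ℂ + ⟪x, translate (unit i) y⟫_ℂ) -
        2 * d * ⟪x, y⟫_ℂ := by
  rw [laplacian_eq, inner_sub_left, sum_inner, inner_smul_left]
  simp [inner_add_left, inner_translate_neg, Complex.conj_ofNat]

theorem laplacian_symmetric (x y : Ell2 d) : ⟪laplacian d x, y⟫_ℂ = ⟪x, laplacian d y⟫_ℂ := by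
  rw [← inner_conj_symm x (laplacian d y), inner_laplacian_left, inner_laplacian_left]
  simp only [map_sub, map_sum, map_add, map_mul, inner_conj_symm]
  simp [add_comm, Complex.conj_ofNat]

theorem re_inner_laplacian (x : Ell2 d) : (⟪laplacian d x, x⟫_ℂ).re = -dirichlet x := by
  have h : ∀ i : Fin d, ‖translate (unit i) x - x‖ ^ 2 =
      2 * ‖x‖ ^ 2 - 2 * (⟪translate (unit i) x, x⟫_ℂ).re := by
    intro i
    have := @norm_sub_sq ℂ _ _ _ _ (translate (unit i) x) x
    rw [(translate (unit i)).norm_map] at this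
    simp only [RCLike.re_to_complex] at this
    linarith
  have h' : ∀ i : Fin d, (⟪x, translate (unit i) x⟫_ℂ).re = (⟪translate (unit i) x, x⟫_ℂ).re := by
    intro i
    rw [← inner_conj_symm, Complex.conj_re]
  have h2 : (⟪x, x⟫_ℂ) = ((‖x‖ ^ 2 : ℝ) : ℂ) := by
    simp [inner_self_eq_norm_sq_to_K]
  rw [inner_laplacian_left, dirichlet, h2]
  simp_rw [h]
  rw [Complex.sub_re, Complex.re_sum]
  simp_rw [Complex.add_re, h']
  rw [show (2 * (d : ℂ) * ((‖x‖ ^ 2 : ℝ) : ℂ)) = ((2 * d * ‖x‖ ^ 2 : ℝ) : ℂ) by push_cast; ring,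
    Complex.ofReal_re]
  simp only [Finset.sum_sub_distrib, Finset.sum_add_distrib, ← Finset.mul_sum, Finset.sum_const,
    Finset.card_univ, Fintype.card_fin, nsmul_eq_mul]
  ring

theorem potential_apply (hσ : 0 < σ) (φ x : Ell2 d) (n : Fin d → ℤ) :
    potential hσ φ x n = ((‖φ n‖ ^ (2 * σ) : ℝ) : ℂ) * x n := rfl

theorem potential_symmetric (hσ : 0 < σ) (φ x y : Ell2 d) :
    ⟪potential hσ φ x, y⟫_ℂ = ⟪x, potential hσ φ y⟫_ℂ := by
  rw [lp.inner_eq_tsum, lp.inner_eq_tsum]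
  congr 1
  ext n
  simp only [potential_apply, RCLike.inner_apply, map_mul, Complex.conj_ofReal]
  ring

theorem hasSum_potentialForm (hσ : 0 < σ) (φ x : Ell2 d) :
    HasSum (fun n => ‖φ n‖ ^ (2 * σ) * ‖x n‖ ^ 2) (⟪potential hσ φ x, x⟫_ℂ).re := by
  have h := Complex.hasSum_re (lp.hasSum_inner (𝕜 := ℂ) (potential hσ φ x) x)
  refine h.congr_fun fun n => ?_
  rw [potential_apply, RCLike.inner_apply, map_mul, Complex.conj_ofReal, mul_left_comm,
    RCLike.mul_conj, Complex.re_ofReal_mul]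
  norm_cast

theorem summable_potentialForm (hσ : 0 < σ) (φ x : Ell2 d) :
    Summable fun n => ‖φ n‖ ^ (2 * σ) * ‖x n‖ ^ 2 := (hasSum_potentialForm hσ φ x).summable

theorem re_inner_potential (hσ : 0 < σ) (φ x : Ell2 d) :
    (⟪potential hσ φ x, x⟫_ℂ).re = potentialForm σ φ x :=
  (hasSum_potentialForm hσ φ x).tsum_eq.symm

theorem potentialForm_nonneg (φ x : Ell2 d) : 0 ≤ potentialForm σ φ x :=
  tsum_nonneg fun _ => by positivity

theorem rpow_two_mul_add_two {r : ℝ} (hr : 0 ≤ r) (hσ : 0 < σ) :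
    r ^ (2 * σ + 2) = r ^ (2 * σ) * r ^ 2 := by
  rw [Real.rpow_add_of_nonneg hr (by positivity) (by norm_num)]
  norm_cast

theorem potentialForm_self (hσ : 0 < σ) (u : Ell2 d) : potentialForm σ u u = powerSum σ u := by
  simp only [potentialForm, powerSum, rpow_two_mul_add_two (norm_nonneg _) hσ]

theorem summable_powerSum (hσ : 0 < σ) (u : Ell2 d) :
    Summable fun n => ‖u n‖ ^ (2 * σ + 2) := by
  simpa only [rpow_two_mul_add_two (norm_nonneg _) hσ] using summable_potentialForm hσ u u

theorem powerSum_nonneg (u : Ell2 d) : 0 ≤ powerSum σ u :=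
  tsum_nonneg fun _ => by positivity

theorem powerSum_pos (hσ : 0 < σ) {u : Ell2 d} (hu : u ≠ 0) : 0 < powerSum σ u := by
  obtain ⟨n, hn⟩ : ∃ n, u n ≠ 0 := by
    by_contra! h
    exact hu (by ext n; simpa using h n)
  exact (summable_powerSum hσ u).tsum_pos (fun _ => by positivity) n
    (Real.rpow_pos_of_pos (norm_pos_iff.2 hn) _)

theorem linearized_symmetric (hσ : 0 < σ) (κ ω : ℝ) (φ x y : Ell2 d) :
    ⟪linearized hσ κ ω φ x, y⟫_ℂ = ⟪x, linearized hσ κ ω φ y⟫_ℂ := by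
  simp only [linearized, sub_apply, add_apply, neg_apply,
    smul_apply, ContinuousLinearMap.id_apply, inner_sub_left, inner_add_left,
    inner_neg_left, inner_smul_left, inner_sub_right, inner_add_right, inner_neg_right,
    inner_smul_right, laplacian_symmetric, potential_symmetric, Complex.conj_ofReal]

theorem linearized_isSelfAdjoint (hσ : 0 < σ) (κ ω : ℝ) (φ : Ell2 d) :
    IsSelfAdjoint (linearized hσ κ ω φ) :=
  ContinuousLinearMap.isSelfAdjoint_iff_isSymmetric.2 fun x y => linearized_symmetric hσ κ ω φ x y

theorem re_inner_linearized (hσ : 0 < σ) (κ ω : ℝ) (φ x : Ell2 d) :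
    (⟪linearized hσ κ ω φ x, x⟫_ℂ).re =
      dirichlet x + ω * ‖x‖ ^ 2 - κ * potentialForm σ φ x := by
  have h2 : (⟪x, x⟫_ℂ) = ((‖x‖ ^ 2 : ℝ) : ℂ) := by
    simp [inner_self_eq_norm_sq_to_K]
  simp only [linearized, sub_apply, add_apply, neg_apply,
    smul_apply, ContinuousLinearMap.id_apply, inner_sub_left, inner_add_left,
    inner_neg_left, inner_smul_left, Complex.conj_ofReal, Complex.sub_re, Complex.add_re,
    Complex.neg_re, Complex.re_ofReal_mul, re_inner_laplacian, re_inner_potential, h2,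
    Complex.ofReal_re]
  ring

theorem linearized_apply (hσ : 0 < σ) (κ ω : ℝ) (φ x : Ell2 d) (n : Fin d → ℤ) :
    linearized hσ κ ω φ x n =
      -(laplacian d x n) + ω * x n - κ * (((‖φ n‖ ^ (2 * σ) : ℝ) : ℂ) * x n) := rfl

/-! ### Scaling, slowly decaying test sequences and the sign of the minimum. -/

theorem dirichlet_smul (a : ℂ) (v : Ell2 d) : dirichlet (a • v) = ‖a‖ ^ 2 * dirichlet v := by
  simp only [dirichlet, map_smul, ← smul_sub, norm_smul, mul_pow, Finset.mul_sum]

theorem powerSum_smul (a : ℂ) (v : Ell2 d) :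
    powerSum σ (a • v) = ‖a‖ ^ (2 * σ + 2) * powerSum σ v := by
  simp only [powerSum, ← tsum_mul_left]
  refine tsum_congr fun n => ?_
  rw [lp.coeFn_smul, Pi.smul_apply, norm_smul, Real.mul_rpow (norm_nonneg _) (norm_nonneg _)]

/-- Minimality on the sphere, transported by scaling to all vectors. -/
theorem IsNormalizedWave.hamiltonian_mul_rpow_le {lam : ℝ} {u : Ell2 d}
    (hu : IsNormalizedWave σ lam u) {v : Ell2 d} {m : ℝ} (hm : 0 < m) (hv : ‖v‖ ^ 2 = lam * m) :
    hamiltonian σ u * m ^ (σ + 1) ≤ dirichlet v * m ^ σ - 1 / (σ + 1) * powerSum σ v := by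
  -- `r • v` lies on the sphere; multiplying its inequality by `m ^ (σ + 1)` clears the
  -- denominators.
  set r : ℝ := m ^ (-(1 / 2) : ℝ) with hr
  have hr0 : 0 ≤ r := by positivity
  have hn : ‖(r : ℂ)‖ = r := by simp [abs_of_nonneg hr0]
  have hr2 : r ^ 2 = m⁻¹ := by
    rw [hr, ← Real.rpow_natCast, ← Real.rpow_mul hm.le, ← Real.rpow_neg_one]
    norm_num
  have hrp : r ^ (2 * σ + 2) = (m ^ (σ + 1))⁻¹ := by
    rw [hr, ← Real.rpow_mul hm.le, ← Real.rpow_neg hm.le]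
    ring_nf
  have h := hu.minimal ((r : ℂ) • v) (by
    rw [norm_smul, hn, mul_pow, hr2, hv]
    field_simp)
  rw [hamiltonian_eq σ (_ • v), dirichlet_smul, powerSum_smul, hn, hr2, hrp] at h
  have hmp : 0 < m ^ (σ + 1) := by positivity
  calc hamiltonian σ u * m ^ (σ + 1)
      ≤ (m⁻¹ * dirichlet v - 1 / (σ + 1) * ((m ^ (σ + 1))⁻¹ * powerSum σ v)) * m ^ (σ + 1) := by
        gcongr
    _ = dirichlet v * (m⁻¹ * m ^ (σ + 1)) - 1 / (σ + 1) * powerSum σ v := by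
        field_simp
    _ = _ := by
        rw [Real.rpow_add_one hm.ne']
        field_simp

theorem summable_exp_neg_mul_abs {a : ℝ} (ha : 0 < a) :
    Summable fun k : ℤ => Real.exp (-a * |(k : ℝ)|) := by
  have h : Summable fun k : ℕ => Real.exp (-a * (k : ℝ)) := by
    have := Real.summable_exp_nat_mul_iff.2 (neg_lt_zero.2 ha)
    simpa only [mul_comm] using this
  refine Summable.of_nat_of_neg ?_ ?_ <;> simpa using h

/-- A finite set of lattice points lies in a box, over which the sum factors into one-dimensional
sums. -/
theorem summable_exp_neg_mul_sum_abs {a : ℝ} (ha : 0 < a) :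
    Summable fun n : Fin d → ℤ => Real.exp (-a * ∑ i, |(n i : ℝ)|) := by
  classical
  refine summable_of_sum_le (c := ∏ _i : Fin d, ∑' k : ℤ, Real.exp (-a * |(k : ℝ)|))
    (fun _ => by positivity) fun s => ?_
  calc ∑ n ∈ s, Real.exp (-a * ∑ i, |(n i : ℝ)|)
      ≤ ∑ n ∈ Fintype.piFinset (fun i => s.image fun n : Fin d → ℤ => n i),
          Real.exp (-a * ∑ i, |(n i : ℝ)|) := by
        refine Finset.sum_le_sum_of_subset_of_nonneg (fun n hn => ?_) fun _ _ _ => by positivity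
        exact Fintype.mem_piFinset.2 fun i => Finset.mem_image_of_mem (fun n => n i) hn
    _ = ∏ i : Fin d, ∑ k ∈ s.image (fun n : Fin d → ℤ => n i), Real.exp (-a * |(k : ℝ)|) := by
        rw [Finset.prod_univ_sum]
        simp only [Finset.mul_sum, Real.exp_sum]
    _ ≤ _ := by
        refine Finset.prod_le_prod (fun _ _ => Finset.sum_nonneg fun _ _ => by positivity)
          fun i _ => ?_
        exact (summable_exp_neg_mul_abs ha).sum_le_tsum _ fun _ _ => by positivity

/-- The exponentially decaying sequence `e^{-ε ∑ |nᵢ|}`. -/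
def expDecay (d : ℕ) {ε : ℝ} (hε : 0 < ε) : Ell2 d :=
  ⟨fun n => (Real.exp (-ε * ∑ i, |(n i : ℝ)|) : ℂ), memℓp_two_iff.2 (by
    refine (summable_exp_neg_mul_sum_abs (d := d) (a := 2 * ε) (by positivity)).congr fun n => ?_
    rw [Complex.norm_real, Real.norm_eq_abs, Real.abs_exp, ← Real.exp_nat_mul]
    congr 1
    push_cast
    ring)⟩

theorem expDecay_apply {ε : ℝ} (hε : 0 < ε) (n : Fin d → ℤ) :
    expDecay d hε n = (Real.exp (-ε * ∑ i, |(n i : ℝ)|) : ℂ) := rfl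

/-- A unit step changes `∑ |nᵢ|` by at most 1, so it multiplies the entry by `e^s` with `|s| ≤ ε ≤
1`, and then `|e^s - 1| ≤ 2|s|`. -/
theorem norm_expDecay_diff_le {ε : ℝ} (hε : 0 < ε) (hε1 : ε ≤ 1) (i : Fin d) (n : Fin d → ℤ) :
    ‖expDecay d hε (n + unit i) - expDecay d hε n‖ ≤ 2 * ε * ‖expDecay d hε n‖ := by
  have hs : ∑ j, |((n + unit i) j : ℝ)| = ∑ j, |(n j : ℝ)| + (|(n i : ℝ) + 1| - |(n i : ℝ)|) := by
    rw [← Finset.add_sum_erase _ _ (Finset.mem_univ i),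
      ← Finset.add_sum_erase Finset.univ (fun j => |(n j : ℝ)|) (Finset.mem_univ i)]
    have : ∀ j ∈ Finset.univ.erase i, |((n + unit i) j : ℝ)| = |(n j : ℝ)| := by
      intro j hj
      simp [unit, Finset.ne_of_mem_erase hj]
    rw [Finset.sum_congr rfl this]
    simp [unit]
    ring
  rw [expDecay_apply, expDecay_apply, ← Complex.ofReal_sub, Complex.norm_real, Complex.norm_real,
    Real.norm_eq_abs, Real.norm_eq_abs, Real.abs_exp, hs, mul_add, Real.exp_add, ← mul_sub_one,
    abs_mul, Real.abs_exp, mul_comm]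
  have hb : |-ε * (|(n i : ℝ) + 1| - |(n i : ℝ)|)| ≤ ε := by
    rw [abs_mul, abs_neg, abs_of_pos hε]
    refine mul_le_of_le_one_right hε.le ?_
    simpa using abs_abs_sub_abs_le ((n i : ℝ) + 1) (n i)
  gcongr
  refine (Real.abs_exp_sub_one_le (hb.trans hε1)).trans ?_
  gcongr

theorem dirichlet_expDecay_le {ε : ℝ} (hε : 0 < ε) (hε1 : ε ≤ 1) :
    dirichlet (expDecay d hε) ≤ d * (2 * ε) ^ 2 * ‖expDecay d hε‖ ^ 2 := by
  calc dirichlet (expDecay d hε)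
      ≤ ∑ _i : Fin d, (2 * ε) ^ 2 * ‖expDecay d hε‖ ^ 2 := by
        refine Finset.sum_le_sum fun i _ => ?_
        rw [norm_diff_sq, norm_sq_eq_tsum, ← tsum_mul_left]
        refine (summable_norm_diff_sq i _).tsum_le_tsum (fun n => ?_)
          ((summable_norm_sq _).mul_left _)
        rw [← mul_pow]
        have := norm_expDecay_diff_le hε hε1 i n
        gcongr
    _ = _ := by simp [mul_assoc]

/-- Drop the nonlinear term: the Dirichlet quotient of `expDecay` is `O(ε²)`, and `ε → 0`. -/
theorem IsNormalizedWave.hamiltonian_nonpos {lam : ℝ} (hσ : 0 < σ) (hlam : 0 < lam) {u : Ell2 d}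
    (hu : IsNormalizedWave σ lam u) : hamiltonian σ u ≤ 0 := by
  have key : ∀ ε ∈ Set.Ioc (0 : ℝ) 1, hamiltonian σ u ≤ d * (2 * ε) ^ 2 * lam := by
    rintro ε ⟨hε, hε1⟩
    have hpos : 0 < ‖expDecay d hε‖ := by
      refine norm_pos_iff.2 fun h => ?_
      have := congrArg (fun f : Ell2 d => f 0) h
      simp [expDecay_apply] at this
    set m := ‖expDecay d hε‖ ^ 2 / lam with hm
    have hm0 : 0 < m := by positivity
    have hnorm : ‖expDecay d hε‖ ^ 2 = lam * m := by
      rw [hm]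
      field_simp
    have h := hu.hamiltonian_mul_rpow_le hm0 hnorm
    have hN : 0 ≤ 1 / (σ + 1) * powerSum σ (expDecay d hε) :=
      mul_nonneg (by positivity) (powerSum_nonneg _)
    have hQ := dirichlet_expDecay_le (d := d) hε hε1
    rw [hnorm] at hQ
    refine le_of_mul_le_mul_right (a := m ^ (σ + 1)) ?_ (by positivity)
    calc hamiltonian σ u * m ^ (σ + 1) ≤ dirichlet (expDecay d hε) * m ^ σ := by linarith
      _ ≤ (d * (2 * ε) ^ 2 * (lam * m)) * m ^ σ := by gcongr
      _ = _ := by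
        rw [Real.rpow_add_one hm0.ne']
        ring
  have hlim : Filter.Tendsto (fun ε : ℝ => d * (2 * ε) ^ 2 * lam) (nhdsWithin 0 (Set.Ioi 0))
      (nhds 0) := by
    have : ContinuousAt (fun ε : ℝ => d * (2 * ε) ^ 2 * lam) 0 := by fun_prop
    simpa [ContinuousAt] using this.tendsto.mono_left nhdsWithin_le_nhds
  refine ge_of_tendsto hlim ?_
  filter_upwards [Ioc_mem_nhdsGT (zero_lt_one' ℝ)] with ε hε using key ε hε

/-! ### Propagation of zeros along the lattice. -/

theorem lattice_induction {P : (Fin d → ℤ) → Prop} {k : Fin d → ℤ} (hk : P k)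
    (hP : ∀ n i, P n → P (n + unit i) ∧ P (n - unit i)) (n : Fin d → ℤ) : P n := by
  have line : ∀ (i : Fin d) (z : ℤ) (m : Fin d → ℤ), P m → P (m + z • unit i) := by
    intro i z
    induction z using Int.induction_on with
    | zero => intro m hm; simpa using hm
    | succ z ih =>
      intro m hm
      rw [add_smul, one_smul, ← add_assoc]
      exact (hP _ i (ih m hm)).1
    | pred z ih =>
      intro m hm
      rw [sub_smul, one_smul, ← add_sub_assoc]
      exact (hP _ i (ih m hm)).2
  -- Adjust the coordinates one at a time.
  have box : ∀ (z : Fin d → ℤ) (s : Finset (Fin d)), P (k + ∑ i ∈ s, z i • unit i) := by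
    intro z s
    induction s using Finset.induction_on with
    | empty => simpa using hk
    | insert i s hi ih =>
      rw [Finset.sum_insert hi, add_comm (z i • unit i), ← add_assoc]
      exact line i _ _ ih
  have h := box (n - k) Finset.univ
  have hs : ∑ i, (n - k) i • unit i = n - k := by
    conv_rhs => rw [← Finset.univ_sum_single (n - k)]
    refine Finset.sum_congr rfl fun i _ => ?_
    ext j
    by_cases hj : j = i
    · subst hj; simp [unit]
    · simp [unit, hj]
  rwa [hs, add_sub_cancel] at h

/-- A non-negative element of the kernel of `-Δ + ω - κ |φ|^{2σ}` with a zero vanishes. -/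
theorem eq_zero_of_linearized_eq_zero (hσ : 0 < σ) {κ ω : ℝ} {φ y : Ell2 d}
    (hy : ∀ n, 0 ≤ y n) (h : linearized hσ κ ω φ y = 0) {k : Fin d → ℤ} (hk : y k = 0) :
    y = 0 := by
  ext n
  refine lattice_induction (P := fun n => y n = 0) hk (fun n i hn => ?_) n
  have h1 : linearized hσ κ ω φ y n = 0 := by rw [h]; rfl
  rw [linearized_apply, laplacian_apply, hn] at h1
  -- At a zero the diagonal terms drop out, and a vanishing sum of non-negative neighbours has only
  -- zero terms.
  have h2 : ∑ i, (y (n + unit i) + y (n - unit i)) = 0 := by simpa using h1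
  have h3 := (Finset.sum_eq_zero_iff_of_nonneg
    fun i _ => add_nonneg (hy (n + unit i)) (hy (n - unit i))).1 h2 i
    (Finset.mem_univ i)
  exact (add_eq_zero_iff_of_nonneg (hy _) (hy _)).1 h3

/-! ### First variation and the Lagrange multiplier. -/

theorem norm_add_smul_sq (u v : Ell2 d) (t : ℝ) :
    ‖u + (t : ℂ) • v‖ ^ 2 = ‖u‖ ^ 2 + 2 * t * (⟪u, v⟫_ℂ).re + t ^ 2 * ‖v‖ ^ 2 := by
  rw [@norm_add_sq ℂ, inner_smul_right, norm_smul, mul_pow]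
  simp
  ring

theorem dirichlet_add_smul (u v : Ell2 d) (t : ℝ) :
    dirichlet (u + (t : ℂ) • v) =
      dirichlet u - 2 * t * (⟪laplacian d u, v⟫_ℂ).re + t ^ 2 * dirichlet v := by
  have h : (⟪laplacian d v, u⟫_ℂ).re = (⟪laplacian d u, v⟫_ℂ).re := by
    rw [laplacian_symmetric, ← inner_conj_symm, Complex.conj_re]
  have h1 := re_inner_laplacian (u + (t : ℂ) • v)
  have h2 := re_inner_laplacian u
  have h3 := re_inner_laplacian v
  simp only [map_add, map_smul, inner_add_left, inner_add_right, inner_smul_left, inner_smul_right,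
    Complex.conj_ofReal, Complex.add_re, Complex.re_ofReal_mul, h, h2, h3] at h1
  linarith

theorem powerSum_add_single (hσ : 0 < σ) (u : Ell2 d) (n : Fin d → ℤ) (z : ℂ) :
    powerSum σ (u + z • lp.single 2 n (1 : ℂ)) =
      powerSum σ u + (‖u n + z‖ ^ (2 * σ + 2) - ‖u n‖ ^ (2 * σ + 2)) := by
  have h := (summable_powerSum hσ (u + z • lp.single 2 n (1 : ℂ))).tsum_sub (summable_powerSum hσ u)
  rw [tsum_eq_single n] at h
  · simp only [powerSum]
    simp only [lp.coeFn_add, lp.coeFn_smul, Pi.add_apply, Pi.smul_apply, lp.single_apply_self,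
      smul_eq_mul, mul_one] at h ⊢
    linarith
  · intro k hk
    have : (u + z • lp.single 2 n (1 : ℂ) : Ell2 d) k =
        u k + z * (lp.single 2 n (1 : ℂ) : Ell2 d) k := rfl
    rw [this, lp.single_apply_ne 2 n _ hk, mul_zero, add_zero, sub_self]

theorem IsNormalizedWave.apply_eq_norm {lam : ℝ} {u : Ell2 d} (hu : IsNormalizedWave σ lam u)
    (n : Fin d → ℤ) : u n = (‖u n‖ : ℂ) := (Complex.norm_of_nonneg' (hu.nonneg n)).symm

/-- The Lagrange multiplier of a normalized wave. -/
def multiplier (σ lam : ℝ) (u : Ell2 d) : ℝ := (powerSum σ u - dirichlet u) / lam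

theorem IsNormalizedWave.ne_zero {lam : ℝ} (hlam : 0 < lam) {u : Ell2 d}
    (hu : IsNormalizedWave σ lam u) : u ≠ 0 := by
  rintro rfl
  have := hu.norm_sq
  simp at this
  linarith

/-- `H[u] ≤ 0` bounds `dirichlet u` by `powerSum σ u / (σ + 1)`, which is less than `powerSum σ u`.
-/
theorem IsNormalizedWave.multiplier_pos {lam : ℝ} (hσ : 0 < σ) (hlam : 0 < lam) {u : Ell2 d}
    (hu : IsNormalizedWave σ lam u) : 0 < multiplier σ lam u := by
  have h := hu.hamiltonian_nonpos hσ hlam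
  rw [hamiltonian_eq] at h
  have hN := powerSum_pos hσ (hu.ne_zero hlam)
  have : 1 / (σ + 1) * powerSum σ u < 1 * powerSum σ u := by
    gcongr
    rw [div_lt_one] <;> linarith
  exact div_pos (by linarith) hlam

theorem IsNormalizedWave.re_eulerLagrange {lam : ℝ} (hσ : 0 < σ) (hlam : 0 < lam) {u : Ell2 d}
    (hu : IsNormalizedWave σ lam u) (n : Fin d → ℤ) :
    -(laplacian d u n).re + multiplier σ lam u * ‖u n‖ - ‖u n‖ ^ (2 * σ) * ‖u n‖ = 0 := by
  set a := ‖u n‖ with ha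
  set e : Ell2 d := lp.single 2 n (1 : ℂ) with he
  have hun : u n = (a : ℂ) := hu.apply_eq_norm n
  have hinner : ∀ x : Ell2 d, (⟪x, e⟫_ℂ).re = (x n).re := by
    intro x
    rw [he, lp.inner_single_right]
    simp
  have hen : ‖e‖ ^ 2 = 1 := by
    rw [he, lp.norm_single (by norm_num)]
    simp
  -- `m t = ‖u + t e‖² / lam`, and `Φ` below is the slack in the scaled minimality inequality:
  -- non-negative near 0 and zero at 0.
  set m : ℝ → ℝ := fun t => 1 + (2 * t * a + t ^ 2) / lam with hm
  have hm0 : m 0 = 1 := by simp [hm]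
  set Φ : ℝ → ℝ := fun t =>
    (dirichlet u - 2 * t * (laplacian d u n).re + t ^ 2 * dirichlet e) * m t ^ σ -
      1 / (σ + 1) * (powerSum σ u + (|a + t| ^ (2 * σ + 2) - a ^ (2 * σ + 2))) -
        hamiltonian σ u * m t ^ (σ + 1) with hΦ
  have hmd : HasDerivAt m (2 * a / lam) 0 := by
    have h1 : HasDerivAt (fun t : ℝ => 2 * t * a + t ^ 2) (2 * a) 0 := by
      refine (((hasDerivAt_id (0 : ℝ)).const_mul 2).mul_const a |>.add
        (hasDerivAt_pow 2 (0 : ℝ))).congr_deriv ?_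
      simp
    exact (h1.div_const lam).const_add 1
  have hmin : IsLocalMin Φ 0 := by
    have hΦ0 : Φ 0 = 0 := by
      simp only [hΦ, hm0, hamiltonian_eq]
      simp [ha]
    have hev : ∀ᶠ t in nhds (0 : ℝ), 0 < m t :=
      hmd.continuousAt.eventually (lt_mem_nhds (by rw [hm0]; norm_num))
    filter_upwards [hev] with t ht
    have h := hu.hamiltonian_mul_rpow_le (v := u + (t : ℂ) • e) ht (by
      rw [norm_add_smul_sq, hinner, hen, hun, hu.norm_sq, Complex.ofReal_re, hm]
      field_simp
      ring)
    rw [dirichlet_add_smul, hinner, he, powerSum_add_single hσ, hun, ← Complex.ofReal_add,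
      Complex.norm_real, Complex.norm_real, Real.norm_eq_abs, Real.norm_eq_abs,
      abs_of_nonneg (norm_nonneg (u n)), ← he] at h
    rw [hΦ0]
    simp only [hΦ]
    linarith
  have hQd : HasDerivAt
      (fun t : ℝ => dirichlet u - 2 * t * (laplacian d u n).re + t ^ 2 * dirichlet e)
      (-(2 * (laplacian d u n).re)) 0 := by
    refine ((((hasDerivAt_id (0 : ℝ)).const_mul 2).mul_const (laplacian d u n).re).const_sub
      (dirichlet u) |>.add ((hasDerivAt_pow 2 (0 : ℝ)).mul_const (dirichlet e))).congr_deriv ?_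
    simp
  have hNd : HasDerivAt (fun t : ℝ => |a + t| ^ (2 * σ + 2))
      ((2 * σ + 2) * (a ^ (2 * σ) * a)) 0 := by
    have h1 := hasDerivAt_abs_rpow (a + 0) (p := 2 * σ + 2) (by linarith)
    refine (HasDerivAt.comp_const_add a 0 h1).congr_deriv ?_
    rw [add_zero, abs_of_nonneg (show 0 ≤ a from norm_nonneg (u n))]
    simp [mul_assoc]
  have hΦd := ((hQd.mul (hmd.rpow_const (p := σ) (by simp [hm0]))).sub
    (((hNd.sub_const (a ^ (2 * σ + 2))).const_add (powerSum σ u)).const_mul (1 / (σ + 1)))).sub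
      ((hmd.rpow_const (p := σ + 1) (by simp [hm0])).const_mul (hamiltonian σ u))
  have hz := hmin.hasDerivAt_eq_zero hΦd
  -- The contributions of `m'` combine through `σ D - (σ + 1) H = N - D`, where `D`, `N` are
  -- `dirichlet u`, `powerSum σ u`; this is `lam` times the multiplier.
  simp only [hm0, hamiltonian_eq, Real.one_rpow] at hz
  rw [multiplier]
  field_simp at hz ⊢
  linear_combination hz / 2

/-! ### Second variation. -/

/-- Midpoint convexity. The sign allows the second difference of `powerSum` to be bounded below by
finite partial sums. -/
theorem two_mul_rpow_le {p : ℝ} (hp : 1 ≤ p) {a : ℝ} (ha : 0 ≤ a) (x : ℝ) :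
    0 ≤ |a + x| ^ p + |a - x| ^ p - 2 * a ^ p := by
  have h := (convexOn_rpow hp).2 (Set.mem_Ici.2 (abs_nonneg (a + x)))
    (Set.mem_Ici.2 (abs_nonneg (a - x))) (show (0 : ℝ) ≤ 1 / 2 by norm_num)
    (show (0 : ℝ) ≤ 1 / 2 by norm_num) (by norm_num)
  have h1 : a ≤ 1 / 2 * |a + x| + 1 / 2 * |a - x| := by
    linarith [le_abs_self (a + x), le_abs_self (a - x)]
  have h2 : a ^ p ≤ (1 / 2 * |a + x| + 1 / 2 * |a - x|) ^ p := by gcongr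
  simp only [smul_eq_mul] at h
  linarith

/-- The symmetric second derivative of `|x| ^ p` at a positive point. -/
theorem tendsto_second_difference_abs_rpow {p : ℝ} (hp : 1 < p) {a : ℝ} (ha : 0 < a) (b : ℝ) :
    Filter.Tendsto (fun t : ℝ => (|a + t * b| ^ p + |a - t * b| ^ p - 2 * a ^ p) / t ^ 2)
      (nhdsWithin 0 (Set.Ioi 0)) (nhds (p * (p - 1) * (a ^ (p - 2) * b ^ 2))) := by
  -- The derivative of `|x| ^ p`; it is differentiated only at `a > 0`.
  set ψ : ℝ → ℝ := fun x => p * |x| ^ (p - 2) * x with hψ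
  have hψd : HasDerivAt ψ (p * (p - 1) * a ^ (p - 2)) a := by
    refine ((((hasDerivAt_abs_pos ha).rpow_const (p := p - 2) (Or.inl (abs_pos.2 ha.ne').ne')).const_mul
      p).mul (hasDerivAt_id a)).congr_deriv ?_
    have : a ^ (p - 2 - 1) * a = a ^ (p - 2) := by
      rw [← Real.rpow_add_one ha.ne', sub_add_cancel]
    simp only [abs_of_pos ha, id]
    linear_combination p * (p - 2) * this
  have hadd : ∀ t : ℝ, HasDerivAt (fun t : ℝ => a + t * b) b t := fun t => by
    simpa using ((hasDerivAt_id t).mul_const b).const_add a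
  have hsub : ∀ t : ℝ, HasDerivAt (fun t : ℝ => a - t * b) (-b) t := fun t => by
    simpa using ((hasDerivAt_id t).mul_const b).const_sub a
  have hf : ∀ t : ℝ, HasDerivAt (fun t : ℝ => |a + t * b| ^ p + |a - t * b| ^ p - 2 * a ^ p)
      (b * (ψ (a + t * b) - ψ (a - t * b))) t := fun t => by
    refine ((((hasDerivAt_abs_rpow _ hp).comp t (hadd t)).add
      ((hasDerivAt_abs_rpow _ hp).comp t (hsub t))).sub_const (2 * a ^ p)).congr_deriv ?_
    simp only [hψ]
    ring
  have hg : ∀ t : ℝ, HasDerivAt (fun t : ℝ => t ^ 2) (2 * t) t := fun t => by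
    simpa using hasDerivAt_pow 2 t
  have hslope : HasDerivAt (fun t : ℝ => ψ (a + t * b) - ψ (a - t * b))
      (p * (p - 1) * a ^ (p - 2) * b - p * (p - 1) * a ^ (p - 2) * (-b)) 0 := by
    have h1 : HasDerivAt ψ (p * (p - 1) * a ^ (p - 2)) (a + 0 * b) := by simpa using hψd
    have h2 : HasDerivAt ψ (p * (p - 1) * a ^ (p - 2)) (a - 0 * b) := by simpa using hψd
    exact (h1.comp (0 : ℝ) (hadd 0)).sub (h2.comp (0 : ℝ) (hsub 0))
  -- After one use of L'Hôpital's rule the quotient is a difference quotient of `ψ` at 0, so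
  -- continuity of a second derivative is not needed.
  refine HasDerivAt.lhopital_zero_nhdsGT (Filter.Eventually.of_forall hf)
    (Filter.Eventually.of_forall hg) ?_ ?_ ?_ ?_
  · filter_upwards [self_mem_nhdsWithin] with t ht
    exact mul_ne_zero two_ne_zero (ne_of_gt ht)
  · have h := (hf 0).continuousAt.tendsto.mono_left (nhdsWithin_le_nhds (s := Set.Ioi 0))
    refine h.congr' ?_ |>.trans (le_of_eq ?_)
    · exact Filter.EventuallyEq.rfl
    · simp [abs_of_pos ha, two_mul]
  · simpa using (hg 0).continuousAt.tendsto.mono_left (nhdsWithin_le_nhds (s := Set.Ioi 0))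
  · have h := (hslope.tendsto_slope_zero_right).const_mul (b / 2)
    refine (h.congr' ?_).trans (le_of_eq ?_)
    · filter_upwards [self_mem_nhdsWithin] with t ht
      have ht' : t ≠ 0 := ne_of_gt ht
      simp
      field_simp
    · congr 1
      ring

theorem IsNormalizedWave.linearized_one_apply {lam : ℝ} (hσ : 0 < σ) (hlam : 0 < lam) {u : Ell2 d}
    (hu : IsNormalizedWave σ lam u) : linearized hσ 1 (multiplier σ lam u) u u = 0 := by
  ext n
  have h := hu.re_eulerLagrange hσ hlam n
  have him : (laplacian d u n).im = 0 := by
    rw [laplacian_apply, Complex.sub_im, Complex.im_sum]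
    rw [Finset.sum_eq_zero]
    · rw [hu.apply_eq_norm n]
      norm_cast
      simp
    · intro i _
      rw [hu.apply_eq_norm (n + _), hu.apply_eq_norm (n - _)]
      simp
  rw [linearized_apply]
  have hre : laplacian d u n = ((laplacian d u n).re : ℂ) := by
    apply Complex.ext <;> simp [him]
  rw [hre]
  generalize (laplacian d u n).re = r at h
  have hn := hu.apply_eq_norm n
  generalize ‖u n‖ = a at h hn
  rw [hn, lp.coeFn_zero, Pi.zero_apply]
  generalize a ^ (2 * σ) = q at h
  have h' := congrArg Complex.ofReal
    (by linarith : -r + multiplier σ lam u * a - 1 * (q * a) = 0)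
  push_cast at h' ⊢
  exact h'

/-- A zero of `u` would spread to all sites. Positivity supplies the base points for the
second-difference limit. -/
theorem IsNormalizedWave.norm_apply_pos {lam : ℝ} (hσ : 0 < σ) (hlam : 0 < lam) {u : Ell2 d}
    (hu : IsNormalizedWave σ lam u) (n : Fin d → ℤ) : 0 < ‖u n‖ := by
  refine norm_pos_iff.2 fun h => hu.ne_zero hlam ?_
  exact eq_zero_of_linearized_eq_zero hσ hu.nonneg (hu.linearized_one_apply hσ hlam) h

/-- The second variation of the Hamiltonian at a normalized wave, in real directions. -/
theorem IsNormalizedWave.second_variation_real {lam : ℝ} (hσ : 0 < σ) (hlam : 0 < lam) {u : Ell2 d}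
    (hu : IsNormalizedWave σ lam u) {v : Ell2 d} (hv : ∀ n, v n = ((v n).re : ℂ))
    (huv : (⟪u, v⟫_ℂ).re = 0) :
    (2 * σ + 1) * potentialForm σ u v ≤ dirichlet v + multiplier σ lam u * ‖v‖ ^ 2 := by
  set p := 2 * σ + 2 with hp
  -- As `v ⊥ u`, `‖u ± t v‖² = lam * (1 + t² k)`.
  set k := ‖v‖ ^ 2 / lam with hk
  have hk0 : 0 ≤ k := by positivity
  set g : (Fin d → ℤ) → ℝ → ℝ := fun n t =>
    |‖u n‖ + t * (v n).re| ^ p + |‖u n‖ - t * (v n).re| ^ p - 2 * ‖u n‖ ^ p with hg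
  have hg0 : ∀ n t, 0 ≤ g n t := fun n t => two_mul_rpow_le (by linarith) (norm_nonneg _) _
  set r : ℝ → ℝ := fun s => 2 * (dirichlet u + s * dirichlet v) * (1 + s * k) ^ σ -
    2 * hamiltonian σ u * (1 + s * k) ^ (σ + 1) - 2 / (σ + 1) * powerSum σ u with hr
  have happ : ∀ (t : ℝ) n, ‖(u + (t : ℂ) • v) n‖ ^ p = |‖u n‖ + t * (v n).re| ^ p := by
    intro t n
    have : (u + (t : ℂ) • v) n = ((‖u n‖ + t * (v n).re : ℝ) : ℂ) := by
      push_cast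
      rw [← hv n, ← hu.apply_eq_norm n]
      rfl
    rw [this, Complex.norm_real, Real.norm_eq_abs]
  -- Adding the inequalities for `t` and `-t` cancels the odd terms. Restricting to a finite `F`
  -- avoids exchanging the limit `t → 0` with an infinite sum.
  have hle : ∀ (F : Finset (Fin d → ℤ)) (t : ℝ), 1 / (σ + 1) * ∑ n ∈ F, g n t ≤ r (t ^ 2) := by
    intro F t
    have hm : 0 < 1 + t ^ 2 * k := by positivity
    have hinst : ∀ s : ℝ, s ^ 2 = t ^ 2 → hamiltonian σ u * (1 + t ^ 2 * k) ^ (σ + 1) ≤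
        (dirichlet u - 2 * s * (⟪laplacian d u, v⟫_ℂ).re + t ^ 2 * dirichlet v) *
          (1 + t ^ 2 * k) ^ σ - 1 / (σ + 1) * powerSum σ (u + (s : ℂ) • v) := by
      intro s hs
      rw [← hs, ← dirichlet_add_smul]
      refine hu.hamiltonian_mul_rpow_le (hs ▸ hm) ?_
      rw [norm_add_smul_sq, huv, hu.norm_sq, hk]
      field_simp
      ring
    have h1 := hinst t rfl
    have h2 := hinst (-t) (by ring)
    have hsum := ((summable_powerSum hσ (u + (t : ℂ) • v)).hasSum.add
      (summable_powerSum hσ (u + ((-t : ℝ) : ℂ) • v)).hasSum).sub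
        ((summable_powerSum hσ u).hasSum.mul_left 2)
    rw [← hp] at hsum
    simp only [happ, neg_mul, ← sub_eq_add_neg] at hsum
    have h3 : ∑ n ∈ F, g n t ≤ powerSum σ (u + (t : ℂ) • v) +
        powerSum σ (u + ((-t : ℝ) : ℂ) • v) - 2 * powerSum σ u := by
      refine (sum_le_hasSum F (fun n _ => hg0 n t) hsum).trans (le_of_eq ?_)
      simp only [powerSum, ← hp, happ, neg_mul, ← sub_eq_add_neg]
    have h4 := mul_le_mul_of_nonneg_left h3 (show 0 ≤ 1 / (σ + 1) by positivity)
    refine h4.trans ?_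
    simp only [hr]
    have : 2 / (σ + 1) * powerSum σ u = 2 * (1 / (σ + 1) * powerSum σ u) := by ring
    rw [this]
    linarith
  have hrd : HasDerivAt r (2 * (dirichlet v + multiplier σ lam u * ‖v‖ ^ 2)) 0 := by
    have h1 : HasDerivAt (fun s : ℝ => 1 + s * k) k 0 := by
      simpa using ((hasDerivAt_id (0 : ℝ)).mul_const k).const_add 1
    have h2 : HasDerivAt (fun s : ℝ => 2 * (dirichlet u + s * dirichlet v)) (2 * dirichlet v) 0 := by
      simpa using (((hasDerivAt_id (0 : ℝ)).mul_const (dirichlet v)).const_add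
        (dirichlet u)).const_mul 2
    refine (((h2.mul (h1.rpow_const (p := σ) (by simp))).sub
      ((h1.rpow_const (p := σ + 1) (by simp)).const_mul (2 * hamiltonian σ u))).sub_const
        (2 / (σ + 1) * powerSum σ u)).congr_deriv ?_
    simp only [zero_mul, add_zero, Real.one_rpow, hamiltonian_eq, multiplier, hk]
    field_simp
    ring
  have hr0 : r 0 = 0 := by
    simp only [hr, zero_mul, add_zero, Real.one_rpow, hamiltonian_eq]
    ring
  have hrlim : Filter.Tendsto (fun t : ℝ => r (t ^ 2) / t ^ 2) (nhdsWithin 0 (Set.Ioi 0))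
      (nhds (2 * (dirichlet v + multiplier σ lam u * ‖v‖ ^ 2))) := by
    have hsq : Filter.Tendsto (fun t : ℝ => t ^ 2) (nhdsWithin 0 (Set.Ioi 0))
        (nhdsWithin 0 (Set.Ioi 0)) := by
      refine tendsto_nhdsWithin_iff.2 ⟨?_, ?_⟩
      · have : ContinuousAt (fun t : ℝ => t ^ 2) 0 := by fun_prop
        simpa [ContinuousAt] using this.tendsto.mono_left (nhdsWithin_le_nhds (s := Set.Ioi 0))
      · filter_upwards [self_mem_nhdsWithin] with t ht
        exact pow_pos (Set.mem_Ioi.1 ht) 2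
    refine (hrd.tendsto_slope_zero_right.comp hsq).congr fun t => ?_
    simp [hr0, div_eq_inv_mul]
  have hpos := hu.norm_apply_pos hσ hlam
  have hF : ∀ F : Finset (Fin d → ℤ), (2 * σ + 1) * ∑ n ∈ F, ‖u n‖ ^ (2 * σ) * ‖v n‖ ^ 2 ≤
      dirichlet v + multiplier σ lam u * ‖v‖ ^ 2 := by
    intro F
    have hglim := (tendsto_finsetSum F fun n _ => tendsto_second_difference_abs_rpow
      (p := p) (by linarith) (hpos n) (v n).re).const_mul (1 / (σ + 1))
    have hcmp := le_of_tendsto_of_tendsto hglim hrlim (by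
      filter_upwards [self_mem_nhdsWithin] with t ht
      rw [← Finset.sum_div, ← mul_div_assoc]
      have := hle F t
      gcongr)
    rw [← Finset.mul_sum, show p - 2 = 2 * σ by rw [hp]; ring] at hcmp
    have hnorm : ∀ n, ‖v n‖ ^ 2 = (v n).re ^ 2 := fun n => by
      rw [hv n, Complex.norm_real, Real.norm_eq_abs, sq_abs, Complex.ofReal_re]
    simp only [hnorm]
    have : 1 / (σ + 1) * (p * (p - 1) * ∑ n ∈ F, ‖u n‖ ^ (2 * σ) * (v n).re ^ 2) =
        2 * ((2 * σ + 1) * ∑ n ∈ F, ‖u n‖ ^ (2 * σ) * (v n).re ^ 2) := by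
      rw [hp]
      field_simp
      ring
    linarith
  have hσ' : 0 < 2 * σ + 1 := by linarith
  rw [← le_div_iff₀' hσ']
  exact (summable_potentialForm hσ u v).tsum_le_of_sum_le fun F => (le_div_iff₀' hσ').2 (hF F)

/-! ### From real to complex directions. -/

/-- The entrywise real part. -/
def realPart (v : Ell2 d) : Ell2 d :=
  ⟨fun n => ((v n).re : ℂ), memℓp_two_iff.2 <| (summable_norm_sq v).of_nonneg_of_le
    (fun _ => by positivity) fun n => by
      rw [Complex.norm_real]
      exact pow_le_pow_left₀ (norm_nonneg _) (Complex.abs_re_le_norm _) 2⟩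

/-- The entrywise absolute value. -/
def absPart (v : Ell2 d) : Ell2 d :=
  ⟨fun n => (‖v n‖ : ℂ), memℓp_two_iff.2 <| by simpa using summable_norm_sq v⟩

theorem realPart_apply (v : Ell2 d) (n : Fin d → ℤ) : realPart v n = ((v n).re : ℂ) := rfl

theorem absPart_apply (v : Ell2 d) (n : Fin d → ℤ) : absPart v n = (‖v n‖ : ℂ) := rfl

/-- `realPart (-I • v)` is the entrywise imaginary part, so the forms decouple into two real ones.
-/
theorem norm_apply_sq_split (v : Ell2 d) (n : Fin d → ℤ) :
    ‖v n‖ ^ 2 = ‖realPart v n‖ ^ 2 + ‖realPart (-Complex.I • v) n‖ ^ 2 := by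
  have h : (-Complex.I • v) n = -Complex.I * v n := rfl
  rw [realPart_apply, realPart_apply, h, Complex.sq_norm, Complex.norm_real, Complex.norm_real,
    Complex.normSq_apply]
  simp
  ring

theorem norm_sq_split (v : Ell2 d) :
    ‖v‖ ^ 2 = ‖realPart v‖ ^ 2 + ‖realPart (-Complex.I • v)‖ ^ 2 := by
  rw [norm_sq_eq_tsum, norm_sq_eq_tsum, norm_sq_eq_tsum,
    ← (summable_norm_sq _).tsum_add (summable_norm_sq _)]
  exact tsum_congr (norm_apply_sq_split v)

theorem potentialForm_split (hσ : 0 < σ) (φ v : Ell2 d) :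
    potentialForm σ φ v =
      potentialForm σ φ (realPart v) + potentialForm σ φ (realPart (-Complex.I • v)) := by
  rw [potentialForm, potentialForm, potentialForm,
    ← (summable_potentialForm hσ _ _).tsum_add (summable_potentialForm hσ _ _)]
  refine tsum_congr fun n => ?_
  rw [norm_apply_sq_split v, mul_add]

theorem realPart_translate_sub (a : Fin d → ℤ) (v : Ell2 d) :
    realPart (translate a v - v) = translate a (realPart v) - realPart v := by
  ext n
  simp [realPart_apply, translate_apply]

theorem dirichlet_split (v : Ell2 d) :
    dirichlet v = dirichlet (realPart v) + dirichlet (realPart (-Complex.I • v)) := by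
  simp only [dirichlet, ← Finset.sum_add_distrib]
  refine Finset.sum_congr rfl fun i _ => ?_
  rw [norm_sq_split, ← realPart_translate_sub, ← realPart_translate_sub, smul_sub, map_smul]

theorem re_inner_realPart {u : Ell2 d} (hu : ∀ n, u n = (‖u n‖ : ℂ)) (v : Ell2 d) :
    (⟪u, realPart v⟫_ℂ).re = (⟪u, v⟫_ℂ).re := by
  refine (Complex.hasSum_re (lp.hasSum_inner (𝕜 := ℂ) u (realPart v))).unique ?_
  refine (Complex.hasSum_re (lp.hasSum_inner (𝕜 := ℂ) u v)).congr_fun fun n => ?_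
  rw [realPart_apply, hu n]
  simp

theorem norm_absPart (v : Ell2 d) : ‖absPart v‖ = ‖v‖ := by
  refine (sq_eq_sq₀ (norm_nonneg _) (norm_nonneg _)).1 ?_
  rw [norm_sq_eq_tsum, norm_sq_eq_tsum]
  simp [absPart_apply]

theorem potentialForm_absPart (φ v : Ell2 d) :
    potentialForm σ φ (absPart v) = potentialForm σ φ v := by
  simp [potentialForm, absPart_apply]

theorem dirichlet_absPart_le (v : Ell2 d) : dirichlet (absPart v) ≤ dirichlet v := by
  refine Finset.sum_le_sum fun i _ => ?_
  rw [norm_diff_sq, norm_diff_sq]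
  refine (summable_norm_diff_sq i _).tsum_le_tsum (fun n => ?_) (summable_norm_diff_sq i _)
  rw [absPart_apply, absPart_apply, ← Complex.ofReal_sub, Complex.norm_real, Real.norm_eq_abs]
  exact pow_le_pow_left₀ (abs_nonneg _) (abs_norm_sub_norm_le _ _) 2

/-- The second variation of the Hamiltonian at a normalized wave. -/
theorem IsNormalizedWave.second_variation {lam : ℝ} (hσ : 0 < σ) (hlam : 0 < lam) {u : Ell2 d}
    (hu : IsNormalizedWave σ lam u) {v : Ell2 d} (huv : ⟪u, v⟫_ℂ = 0) :
    (2 * σ + 1) * potentialForm σ u v ≤ dirichlet v + multiplier σ lam u * ‖v‖ ^ 2 := by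
  have h1 := hu.second_variation_real hσ hlam (v := realPart v) (fun n => by simp [realPart_apply])
    (by rw [re_inner_realPart hu.apply_eq_norm, huv, Complex.zero_re])
  have h2 := hu.second_variation_real hσ hlam (v := realPart (-Complex.I • v))
    (fun n => by simp [realPart_apply])
    (by rw [re_inner_realPart hu.apply_eq_norm, inner_smul_right, huv, mul_zero, Complex.zero_re])
  rw [potentialForm_split hσ, dirichlet_split, norm_sq_split v]
  linarith

theorem IsNormalizedWave.re_inner_linearized_nonneg {lam : ℝ} (hσ : 0 < σ) (hlam : 0 < lam)
    {u : Ell2 d} (hu : IsNormalizedWave σ lam u) {v : Ell2 d} (huv : ⟪u, v⟫_ℂ = 0) :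
    0 ≤ (⟪linearized hσ (2 * σ + 1) (multiplier σ lam u) u v, v⟫_ℂ).re := by
  rw [re_inner_linearized]
  linarith [hu.second_variation hσ hlam huv]

/-! ### Positivity and kernel of `L₋`. -/

/-- Removing the `u`-component does not change the form, and on `{u}ᗮ` the form of `L₋` exceeds that
of `L₊` by `2σ` times `potentialForm`. -/
theorem IsNormalizedWave.linearized_one_isPositive {lam : ℝ} (hσ : 0 < σ) (hlam : 0 < lam)
    {u : Ell2 d} (hu : IsNormalizedWave σ lam u) :
    (linearized hσ 1 (multiplier σ lam u) u).IsPositive := by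
  refine ⟨fun x y => linearized_symmetric hσ _ _ u x y, fun x => ?_⟩
  set S := linearized hσ 1 (multiplier σ lam u) u with hS
  have hSu : S u = 0 := hu.linearized_one_apply hσ hlam
  have huu : ⟪u, u⟫_ℂ ≠ 0 := inner_self_ne_zero.2 (hu.ne_zero hlam)
  set t := ⟪u, x⟫_ℂ / ⟪u, u⟫_ℂ with ht
  set v := x - t • u with hv
  have huv : ⟪u, v⟫_ℂ = 0 := by
    rw [hv, inner_sub_right, inner_smul_right, ht, div_mul_cancel₀ _ huu, sub_self]
  have hSv : S v = S x := by rw [hv, map_sub, map_smul, hSu, smul_zero, sub_zero]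
  have hx : ⟪S x, x⟫_ℂ = ⟪S v, v⟫_ℂ := by
    have : ⟪S x, u⟫_ℂ = 0 := by rw [hS, linearized_symmetric, ← hS, hSu, inner_zero_right]
    rw [hSv, hv, inner_sub_right, inner_smul_right, this, mul_zero, sub_zero]
  change 0 ≤ (⟪S x, x⟫_ℂ).re
  rw [hx, hS, re_inner_linearized]
  nlinarith [hu.second_variation hσ hlam huv, potentialForm_nonneg (σ := σ) u v]

/-- A positive operator vanishes where its quadratic form does. -/
theorem apply_eq_zero_of_re_inner_eq_zero {E : Type*} [NormedAddCommGroup E]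
    [InnerProductSpace ℂ E] {S : E →L[ℂ] E} (hS : S.IsPositive) {x : E}
    (hx : (⟪S x, x⟫_ℂ).re ≤ 0) : S x = 0 := by
  -- The form at `x + t S x`, with `⟨Sx, x⟩ ≤ 0` replaced by 0; its discriminant `4‖Sx‖⁴` must be
  -- non-positive.
  have key : ∀ t : ℝ, 0 ≤ (⟪S (S x), S x⟫_ℂ).re * (t * t) + 2 * ‖S x‖ ^ 2 * t + 0 := by
    intro t
    have h := hS.re_inner_nonneg_left (x + (t : ℂ) • S x)
    have h1 : ⟪S (S x), x⟫_ℂ = ⟪S x, S x⟫_ℂ := hS.isSymmetric (S x) x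
    have h2 : (⟪S x, S x⟫_ℂ).re = ‖S x‖ ^ 2 := by
      simpa using inner_self_eq_norm_sq (𝕜 := ℂ) (S x)
    simp only [map_add, map_smul, inner_add_left, inner_add_right, inner_smul_left,
      inner_smul_right, Complex.conj_ofReal, h1, RCLike.re_to_complex, Complex.add_re,
      Complex.re_ofReal_mul, h2] at h
    linarith
  have h := discrim_le_zero key
  rw [discrim, mul_zero, sub_zero] at h
  have : ‖S x‖ ^ 2 = 0 := by nlinarith [sq_nonneg (2 * ‖S x‖ ^ 2)]
  simpa using this

theorem IsNormalizedWave.ker_linearized_one {lam : ℝ} (hσ : 0 < σ) (hlam : 0 < lam)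
    {u : Ell2 d} (hu : IsNormalizedWave σ lam u) :
    (linearized hσ 1 (multiplier σ lam u) u).ker = Submodule.span ℂ {u} := by
  set S := linearized hσ 1 (multiplier σ lam u) u with hS
  have hSu : S u = 0 := hu.linearized_one_apply hσ hlam
  refine le_antisymm (fun w hw => ?_) ?_
  · have hw' : S w = 0 := hw
    have hu0 : u 0 ≠ 0 := norm_pos_iff.1 (hu.norm_apply_pos hσ hlam 0)
    -- Normalized to vanish at the origin. Taking absolute values cannot raise the form of `S`, so
    -- `absPart y` is also in the kernel.
    set y := w - (w 0 / u 0) • u with hy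
    have hSy : S y = 0 := by rw [hy, map_sub, map_smul, hSu, hw', smul_zero, sub_zero]
    have hy0 : absPart y 0 = 0 := by
      have : y 0 = w 0 - w 0 / u 0 * u 0 := rfl
      rw [absPart_apply, this, div_mul_cancel₀ _ hu0]
      simp
    have hSabs : S (absPart y) = 0 := by
      refine apply_eq_zero_of_re_inner_eq_zero (hu.linearized_one_isPositive hσ hlam) ?_
      have h1 : (⟪S y, y⟫_ℂ).re = 0 := by rw [hSy, inner_zero_left, Complex.zero_re]
      rw [re_inner_linearized] at h1 ⊢
      rw [norm_absPart, potentialForm_absPart]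
      linarith [dirichlet_absPart_le y]
    have habs : absPart y = 0 := eq_zero_of_linearized_eq_zero hσ
      (fun n => by rw [absPart_apply]; exact Complex.zero_le_real.2 (norm_nonneg _)) hSabs hy0
    have hyz : y = 0 := by rw [← norm_eq_zero, ← norm_absPart, habs, norm_zero]
    exact Submodule.mem_span_singleton.2 ⟨w 0 / u 0, (sub_eq_zero.1 hyz).symm⟩
  · rw [Submodule.span_singleton_le_iff_mem]
    exact hSu

/-! ### Closed range and solvability. -/

theorem finite_potential_gt (hσ : 0 < σ) (φ : Ell2 d) {κ ε : ℝ} (hε : 0 < ε) :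
    {n | ε < κ * ‖φ n‖ ^ (2 * σ)}.Finite := by
  have h : Filter.Tendsto (fun n => κ * (‖φ n‖ ^ 2) ^ σ) Filter.cofinite (nhds 0) := by
    have := ((summable_norm_sq φ).tendsto_cofinite_zero.rpow_const (p := σ)
      (Or.inr hσ.le)).const_mul κ
    rwa [Real.zero_rpow hσ.ne', mul_zero] at this
  have h2 := h.eventually (gt_mem_nhds hε)
  rw [Filter.eventually_cofinite] at h2
  refine h2.subset fun n hn => ?_
  have : (‖φ n‖ ^ 2) ^ σ = ‖φ n‖ ^ (2 * σ) := by
    rw [Real.rpow_mul (norm_nonneg _)]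
    norm_cast
  simpa [this] using le_of_lt hn

/-- The subspace of sequences vanishing on a finite set, as the kernel of the restriction map. -/
def vanishingOn (F : Finset (Fin d → ℤ)) : Submodule ℂ (Ell2 d) :=
  LinearMap.ker (LinearMap.pi fun n : F => lp.evalₗ (𝕜 := ℂ) (fun _ : Fin d → ℤ => ℂ) 2 (n : Fin d → ℤ))

theorem mem_vanishingOn {F : Finset (Fin d → ℤ)} {x : Ell2 d} :
    x ∈ vanishingOn F ↔ ∀ n ∈ F, x n = 0 := by
  simp [vanishingOn, funext_iff]

theorem isClosed_vanishingOn (F : Finset (Fin d → ℤ)) :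
    IsClosed (vanishingOn F : Set (Ell2 d)) := by
  have : (vanishingOn F : Set (Ell2 d)) = ⋂ n ∈ F, {x | x n = 0} := by
    ext x
    simp [mem_vanishingOn]
  rw [this]
  refine isClosed_biInter fun n _ => isClosed_eq ?_ continuous_const
  exact (lp.evalCLM (𝕜 := ℂ) (fun _ : Fin d → ℤ => ℂ) 2 n).continuous

/-- Off a finite set the potential is at most `ω / 2`, so the operator is bounded below on a closed
subspace of finite codimension. The image of that subspace is closed, and adding finitely many
dimensions keeps the range closed. -/
theorem isClosed_range_linearized (hσ : 0 < σ) {κ ω : ℝ} (hω : 0 < ω) (φ : Ell2 d) :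
    IsClosed (Set.range (linearized hσ κ ω φ)) := by
  set T := linearized hσ κ ω φ with hT
  set F := (finite_potential_gt hσ φ (κ := κ) (half_pos hω)).toFinset with hF
  have : CompleteSpace (vanishingOn F) := (isClosed_vanishingOn F).completeSpace_coe
  have : (vanishingOn F).CoFG := Submodule.CoFG.ker _
  have hlow : ∀ x ∈ vanishingOn F, ω / 2 * ‖x‖ ≤ ‖T x‖ := by
    intro x hx
    have hV : κ * potentialForm σ φ x ≤ ω / 2 * ‖x‖ ^ 2 := by
      rw [potentialForm, norm_sq_eq_tsum, ← tsum_mul_left, ← tsum_mul_left]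
      refine ((summable_potentialForm hσ φ x).mul_left κ).tsum_le_tsum (fun n => ?_)
        ((summable_norm_sq x).mul_left _)
      rw [← mul_assoc]
      by_cases hn : n ∈ F
      · simp [mem_vanishingOn.1 hx n hn]
      · have hn' : κ * ‖φ n‖ ^ (2 * σ) ≤ ω / 2 := by simpa [hF] using hn
        gcongr
    have h1 : (⟪T x, x⟫_ℂ).re ≤ ‖T x‖ * ‖x‖ := re_inner_le_norm (𝕜 := ℂ) (T x) x
    rw [hT, re_inner_linearized, ← hT] at h1
    have h2 : ω / 2 * ‖x‖ * ‖x‖ ≤ ‖T x‖ * ‖x‖ := by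
      nlinarith [dirichlet_nonneg x]
    rcases (norm_nonneg x).eq_or_lt with h0 | h0
    · simp [← h0]
    · exact le_of_mul_le_mul_right h2 h0
  have hanti : AntilipschitzWith (ω / 2).toNNReal⁻¹ (T ∘L (vanishingOn F).subtypeL) := by
    refine ContinuousLinearMap.antilipschitz_of_bound _ fun x => ?_
    rw [NNReal.coe_inv, Real.coe_toNNReal _ (half_pos hω).le, inv_mul_eq_div,
      le_div_iff₀' (half_pos hω)]
    exact hlow x x.2
  have hcl := hanti.isClosed_range (T ∘L (vanishingOn F).subtypeL).uniformContinuous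
  refine LinearMap.isClosed_range_of_isClosed_map_of_finiteDimensional_quotient
    (f := (T : Ell2 d →ₗ[ℂ] Ell2 d)) (s := vanishingOn F) ?_
  convert hcl using 1
  ext y
  simp

/-- By self-adjointness `(ker T)ᗮ` is the closure of the range, hence the range itself; a preimage
is then projected off the kernel. -/
theorem exists_preimage_of_mem_ker_orthogonal (hσ : 0 < σ) {κ ω : ℝ} (hω : 0 < ω) (φ : Ell2 d)
    {y : Ell2 d} (hy : y ∈ (linearized hσ κ ω φ).kerᗮ) :
    ∃ x ∈ (linearized hσ κ ω φ).kerᗮ, linearized hσ κ ω φ x = y := by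
  set T := linearized hσ κ ω φ with hT
  have hcl : IsClosed (T.range : Set (Ell2 d)) := isClosed_range_linearized hσ hω φ
  rw [T.orthogonal_ker, (linearized_isSelfAdjoint hσ κ ω φ).adjoint_eq,
    hcl.submodule_topologicalClosure_eq] at hy
  obtain ⟨x, hx⟩ := hy
  have : CompleteSpace T.ker := T.isClosed_ker.completeSpace_coe
  obtain ⟨a, ha, b, hb, hab⟩ := T.ker.exists_add_mem_mem_orthogonal x
  refine ⟨b, hb, ?_⟩
  have ha' : T a = 0 := ha
  have hx' : T x = y := hx
  rw [← hx', hab, map_add, ha', zero_add]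

theorem eq_of_mem_ker_orthogonal {E : Type*} [NormedAddCommGroup E] [InnerProductSpace ℂ E]
    {T : E →L[ℂ] E} {x y : E} (hx : x ∈ T.kerᗮ) (hy : y ∈ T.kerᗮ) (h : T x = T y) : x = y := by
  have h1 : x - y ∈ T.ker := by
    change T (x - y) = 0
    rw [map_sub, h, sub_self]
  exact sub_eq_zero.1 (inner_self_eq_zero.1 ((T.kerᗮ.sub_mem hx hy) _ h1 : ⟪x - y, x - y⟫_ℂ = 0))

/-! ### Abstract consequences of non-negativity on `{u}ᗮ`. -/

section Constrained

variable {E : Type*} [NormedAddCommGroup E] [InnerProductSpace ℂ E] {T : E →L[ℂ] E} {u : E}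

/-- If the form of a symmetric operator is negative at `u` and non-negative on `{u}ᗮ`, then its
kernel is orthogonal to `u`. -/
theorem mem_ker_orthogonal_of_constrained (hT : ∀ x y, ⟪T x, y⟫_ℂ = ⟪x, T y⟫_ℂ)
    (hneg : (⟪T u, u⟫_ℂ).re < 0) (hpos : ∀ v, ⟪u, v⟫_ℂ = 0 → 0 ≤ (⟪T v, v⟫_ℂ).re) :
    u ∈ T.kerᗮ := by
  intro ψ hψ
  have hψ' : T ψ = 0 := hψ
  rw [inner_eq_zero_symm]
  by_contra h
  -- Chosen so that `v ⊥ u`, while `T v = T u` keeps the form negative.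
  set v := u - (⟪u, u⟫_ℂ / ⟪u, ψ⟫_ℂ) • ψ with hv
  have huv : ⟪u, v⟫_ℂ = 0 := by
    rw [hv, inner_sub_right, inner_smul_right, div_mul_cancel₀ _ h, sub_self]
  have hTv : ⟪T v, v⟫_ℂ = ⟪T u, u⟫_ℂ := by
    have h1 : T v = T u := by rw [hv, map_sub, map_smul, hψ', smul_zero, sub_zero]
    rw [h1, hv, inner_sub_right, inner_smul_right, hT u ψ, hψ', inner_zero_right, mul_zero,
      sub_zero]
  have := hpos v huv
  rw [hTv] at this
  linarith

/-- If `s = ⟨φ, u⟩ > 0`, then `u - t φ` with `t = ‖u‖² / s` is orthogonal to `u`, yet its form is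
`⟨Tu, u⟩ - t‖u‖² < 0`. -/
theorem inner_nonpos_of_constrained (hT : ∀ x y, ⟪T x, y⟫_ℂ = ⟪x, T y⟫_ℂ)
    (hneg : (⟪T u, u⟫_ℂ).re < 0) (hpos : ∀ v, ⟪u, v⟫_ℂ = 0 → 0 ≤ (⟪T v, v⟫_ℂ).re) {φ : E}
    (hφ : T φ = u) : ⟪φ, u⟫_ℂ ≤ 0 := by
  have him : (⟪φ, u⟫_ℂ).im = 0 := by
    rw [← Complex.conj_eq_iff_im, inner_conj_symm]
    conv_lhs => rw [← hφ]
    conv_rhs => rw [← hφ]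
    exact hT φ φ
  refine Complex.nonpos_iff.2 ⟨?_, him⟩
  by_contra! h
  set s := (⟪φ, u⟫_ℂ).re with hs
  have hφu : ⟪φ, u⟫_ℂ = (s : ℂ) := Complex.ext rfl him
  have huφ : ⟪u, φ⟫_ℂ = (s : ℂ) := by rw [← inner_conj_symm, hφu, Complex.conj_ofReal]
  have huu : ⟪u, u⟫_ℂ = ((‖u‖ ^ 2 : ℝ) : ℂ) := by simp [inner_self_eq_norm_sq_to_K]
  set t : ℝ := ‖u‖ ^ 2 / s with ht
  have hts : t * s = ‖u‖ ^ 2 := div_mul_cancel₀ _ h.ne'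
  have hv := hpos (u - (t : ℂ) • φ) (by
    rw [inner_sub_right, inner_smul_right, huφ, huu, ← Complex.ofReal_mul, hts, sub_self])
  have hTuφ : ⟪T u, φ⟫_ℂ = ((‖u‖ ^ 2 : ℝ) : ℂ) := by rw [hT, hφ, huu]
  simp only [map_sub, map_smul, inner_sub_left, inner_sub_right, inner_smul_left,
    inner_smul_right, Complex.conj_ofReal, hφ, hTuφ, huφ, huu, Complex.sub_re,
    Complex.re_ofReal_mul, Complex.ofReal_re, hts] at hv
  have ht0 : 0 ≤ t := by positivity
  nlinarith [mul_nonneg ht0 (sq_nonneg ‖u‖)]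

/-- The spectral problem `-S w = μ v`, `T v = μ w` has no solution with `Re μ > 0` when `S` is
positive with `u` in its kernel and the form of `T` is non-negative on `{u}ᗮ`. -/
theorem eq_zero_of_hamiltonian_eigenvector {S : E →L[ℂ] E} (hS : S.IsPositive)
    (hSu : S u = 0) (hT : ∀ x y, ⟪T x, y⟫_ℂ = ⟪x, T y⟫_ℂ)
    (hpos : ∀ v, ⟪u, v⟫_ℂ = 0 → 0 ≤ (⟪T v, v⟫_ℂ).re) {μ : ℂ} {v w : E} (hμ : 0 < μ.re)
    (hw : -(S w) = μ • v) (hv : T v = μ • w) : v = 0 ∧ w = 0 := by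
  have hμ0 : μ ≠ 0 := by
    rintro rfl
    simp at hμ
  have huv : ⟪u, v⟫_ℂ = 0 := by
    have h : ⟪u, μ • v⟫_ℂ = 0 := by
      have h1 : ⟪S u, w⟫_ℂ = ⟪u, S w⟫_ℂ := hS.isSymmetric u w
      rw [← hw, inner_neg_right, ← h1, hSu, inner_zero_left, neg_zero]
    rw [inner_smul_right] at h
    exact (mul_eq_zero.1 h).resolve_left hμ0
  -- `μ a = ⟨v, Tv⟩ ≥ 0` and `-μ ā = ⟨w, Sw⟩ ≥ 0` are both real; with `Re μ > 0` this forces `a =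
  -- 0`.
  set a := ⟪v, w⟫_ℂ with ha
  have hTre : 0 ≤ (μ * a).re := by
    have h := hpos v huv
    rwa [hT, hv, inner_smul_right] at h
  have hTim : (μ * a).im = 0 := by
    have h : (starRingEnd ℂ) ⟪v, T v⟫_ℂ = ⟪v, T v⟫_ℂ := by rw [inner_conj_symm, hT]
    rw [hv, inner_smul_right] at h
    exact Complex.conj_eq_iff_im.1 h
  have hSw : S w = -(μ • v) := by rw [← hw, neg_neg]
  have hSin : ⟪w, S w⟫_ℂ = -(μ * (starRingEnd ℂ) a) := by
    rw [hSw, inner_neg_right, inner_smul_right, ha, inner_conj_symm]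
  have hSre : (μ * (starRingEnd ℂ) a).re ≤ 0 := by
    have h := hS.re_inner_nonneg_right w
    rw [hSin, RCLike.re_to_complex, Complex.neg_re] at h
    linarith
  have hSim : (μ * (starRingEnd ℂ) a).im = 0 := by
    have h1 : ⟪S w, w⟫_ℂ = ⟪w, S w⟫_ℂ := hS.isSymmetric w w
    have h : (starRingEnd ℂ) ⟪w, S w⟫_ℂ = ⟪w, S w⟫_ℂ := by rw [inner_conj_symm, h1]
    rw [hSin] at h
    exact neg_eq_zero.1 ((Complex.neg_im _).symm.trans (Complex.conj_eq_iff_im.1 h))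
  simp only [Complex.mul_re, Complex.mul_im, Complex.conj_re, Complex.conj_im] at hTre hTim hSre hSim
  have h1 : a.re = 0 := by
    have : μ.im * a.re = 0 := by linarith
    rcases mul_eq_zero.1 this with h | h
    · rw [h] at hTre hSre
      have h2 : 0 ≤ μ.re * a.re := by linarith
      have h3 : μ.re * a.re ≤ 0 := by linarith
      exact (mul_eq_zero.1 (le_antisymm h3 h2)).resolve_left hμ.ne'
    · exact h
  have h2 : a.im = 0 := by
    rw [h1] at hTim
    exact (mul_eq_zero.1 (by linarith : μ.re * a.im = 0)).resolve_left hμ.ne'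
  have ha0 : a = 0 := Complex.ext h1 h2
  have hSw0 : S w = 0 := by
    refine apply_eq_zero_of_re_inner_eq_zero hS ?_
    have h1 : ⟪S w, w⟫_ℂ = ⟪w, S w⟫_ℂ := hS.isSymmetric w w
    rw [h1, hSin, ha0]
    simp
  have hv0 : v = 0 := by
    rw [hSw0, neg_zero] at hw
    exact (smul_eq_zero.1 hw.symm).resolve_left hμ0
  refine ⟨hv0, ?_⟩
  rw [hv0, map_zero] at hv
  exact (smul_eq_zero.1 hv.symm).resolve_left hμ0

end Constrained

end DNLS

end

theorem theorem2p2 (d : ℕ) (hd : 1 ≤ d) (σ lam : ℝ) (hσ : 0 < σ) (hσd : σ < 2 / (d : ℝ))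
    (hlam : 0 < lam) (u : DNLS.Ell2 d) (hu : DNLS.IsNormalizedWave σ lam u) :
    -- the Lagrange multiplier of the wave
    ∃ c : ℝ, 0 < c ∧
      (∀ n, -(DNLS.laplacian d u n) + c * u n - ((‖u n‖ ^ (2 * σ) : ℝ) : ℂ) * u n = 0) ∧
      -- the operator `L₋`
      (DNLS.Lminus hσ c u).IsPositive ∧
      (DNLS.Lminus hσ c u).ker = Submodule.span ℂ {u} ∧
      -- `u ⊥ ker L₊`
      u ∈ (DNLS.Lplus hσ c u).kerᗮ ∧
      -- `φ = L₊⁻¹ u`, uniquely defined in `(ker L₊)ᗮ`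
      ∃ φ ∈ (DNLS.Lplus hσ c u).kerᗮ, DNLS.Lplus hσ c u φ = u ∧
        (∀ ψ ∈ (DNLS.Lplus hσ c u).kerᗮ, DNLS.Lplus hσ c u ψ = u → ψ = φ) ∧
        ⟪φ, u⟫_ℂ ≤ 0 ∧
        (⟪φ, u⟫_ℂ ≠ 0 → ⟪φ, u⟫_ℂ < 0 ∧ DNLS.IsSpectrallyStable hσ c u) := by
  set c := DNLS.multiplier σ lam u
  have hc0 : 0 < c := hu.multiplier_pos hσ hlam
  have hSu := hu.linearized_one_apply hσ hlam
  have hS := hu.linearized_one_isPositive hσ hlam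
  have hsym := DNLS.linearized_symmetric hσ (2 * σ + 1) c u
  have hpos : ∀ v, ⟪u, v⟫_ℂ = 0 → 0 ≤ (⟪DNLS.linearized hσ (2 * σ + 1) c u v, v⟫_ℂ).re :=
    fun v huv => hu.re_inner_linearized_nonneg hσ hlam huv
  -- Subtracting `⟨L₋u, u⟩ = 0` leaves `-2σ * powerSum σ u`.
  have hneg : (⟪DNLS.linearized hσ (2 * σ + 1) c u u, u⟫_ℂ).re < 0 := by
    have h : (⟪DNLS.linearized hσ 1 c u u, u⟫_ℂ).re = 0 := by
      rw [hSu, inner_zero_left, Complex.zero_re]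
    rw [DNLS.re_inner_linearized] at h ⊢
    have hN := DNLS.powerSum_pos hσ (hu.ne_zero hlam)
    rw [← DNLS.potentialForm_self hσ] at hN
    nlinarith [mul_pos hσ hN]
  have hker := DNLS.mem_ker_orthogonal_of_constrained hsym hneg hpos
  obtain ⟨φ, hφ, hφu⟩ := DNLS.exists_preimage_of_mem_ker_orthogonal hσ hc0 u hker
  have hle := DNLS.inner_nonpos_of_constrained hsym hneg hpos hφu
  refine ⟨c, hc0, fun n => ?_, ?_, ?_, hker, φ, hφ, hφu,
    fun ψ hψ hψu => DNLS.eq_of_mem_ker_orthogonal hψ hφ (hψu.trans hφu.symm), hle,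
    fun hne => ⟨lt_of_le_of_ne hle hne, ?_⟩⟩
  · have h := congrArg (fun f : DNLS.Ell2 d => f n) hSu
    simp only [DNLS.linearized_apply, Complex.ofReal_one, one_mul] at h
    exact h
  · rw [DNLS.Lminus_eq_linearized]
    exact hS
  · rw [DNLS.Lminus_eq_linearized]
    exact hu.ker_linearized_one hσ hlam
  · intro μ v w hμ hw hv
    rw [DNLS.Lminus_eq_linearized] at hw
    exact DNLS.eq_zero_of_hamiltonian_eigenvector hS hSu hsym hpos hμ hw hv
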